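/- Let $g,n\ge 1$ and let $\mathbb R\langle x\rangle$ be the algebra of polynomials with real coefficients in the noncommuting variables $x=(x_1,\dots,x_g)$, with the involution $q\mapsto q^T$ that is linear, reverses words and satisfies $x_j^T=x_j$. The degree of a polynomial is the maximal length $|m|$ of a word $m$ that appears in it with nonzero coefficient (the zero polynomial has degree $0$). Let $p\in\mathbb R\langle x\rangle$ be symmetric ($p=p^T$) of degree $d$. In $\mathbb R\langle x,h\rangle$, with further variables $h=(h_1,\dots,h_g)$, $h_j^T=h_j$, let $p'(x)[h]$ be the coefficient of $t$ in $p(x+th)$ and let $p''(x)[h]$ be twice the coefficient of $t^2$. For $\lambda,\delta\in\mathbb R$ the relaxed Hessian of $p$ is $$p''_{\lambda,\delta}(x)[h]=p''(x)[h]+\delta\sum_{j=1}^g\ \sum_{|m|\le d-1}m(x)^Th_j^2\,m(x)+\lambda\,p'(x)[h]^T\,p'(x)[h],$$ where $m$ runs over the words in $x_1,\dots,x_g$ of length at most $d-1$. Write $\mathbb S_n$ for the space of real symmetric $n\times n$ matrices. The relaxed Hessian is positive at $(X,v)\in\mathbb S_n^g\times\mathbb R^n$ if for every $\delta>0$ there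 is a $\lambda>0$ such that $\langle p''_{\lambda,\delta}(X)[H]v,v\rangle\ge 0$ for all $H\in\mathbb S_n^g$. **Theorem.** Let $\widetilde\nu=1+g+\cdots+g^{d-1}$ (so $\widetilde\nu=0$ if $d=0$) and suppose $n>\frac12\,g\,\widetilde\nu(\widetilde\nu-1)$. Let $X\in\mathbb S_n^g$ and $v\in\mathbb R^n$ be such that $q(X)v\ne 0$ for every nonzero (not necessarily symmetric) $q\in\mathbb R\langle x\rangle$ of degree less than $d$. If the relaxed Hessian of $p$ is positive at $(X,v)$, then $p$ has degree at most $2$ and is matrix convex: for every $N\ge 1$, all $Y,Z\in\mathbb S_N^g$ and all $0\le t\le 1$, the matrix $t\,p(Y)+(1-t)\,p(Z)-p(tY+(1-t)Z)$ is positive semidefinite. -/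

import Mathlib

noncomputable section

/-- `ℝ⟨σ⟩`: polynomials with real coefficients in noncommuting indeterminates indexed by `σ`,
that is, finite linear combinations of words in `σ`. -/
abbrev NCPoly (σ : Type*) : Type _ := MonoidAlgebra ℝ (FreeMonoid σ)

namespace NCPoly

variable {σ : Type*}

/-- The monomial given by the word `w` (first letter of the list = leftmost letter). -/
def monomial (w : List σ) : NCPoly σ := MonoidAlgebra.single (FreeMonoid.ofList w) 1

/-- The indeterminate with index `i`. -/
def var (i : σ) : NCPoly σ := monomial [i]

/-- The linear extension to polynomials of a function given on words. -/
def extend {V : Type*} [AddCommGroup V] [Module ℝ V] (f : List σ → V) : NCPoly σ →ₗ[ℝ] V :=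
  (Finsupp.linearCombination ℝ fun w : FreeMonoid σ => f w.toList) ∘ₗ
    (MonoidAlgebra.coeffLinearEquiv (R := ℝ)).toLinearMap

/-- The degree: the maximal length of a word that appears with a nonzero coefficient
(and `0` for the zero polynomial). -/
def degree (p : NCPoly σ) : ℕ := p.coeff.support.sup FreeMonoid.length

/-- The involution: it reverses words and fixes each indeterminate. -/
def transpose : NCPoly σ →ₗ[ℝ] NCPoly σ := extend fun w => monomial w.reverse

/-- A polynomial is symmetric if it equals its transpose. -/
def IsSymmetric (p : NCPoly σ) : Prop := transpose p = p

/-- Evaluation at a tuple of `n × n` matrices; the constant term `c` becomes `c I`. -/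
def eval {n : ℕ} (X : σ → Matrix (Fin n) (Fin n) ℝ) :
    NCPoly σ →ₐ[ℝ] Matrix (Fin n) (Fin n) ℝ :=
  MonoidAlgebra.lift ℝ (Matrix (Fin n) (Fin n) ℝ) (FreeMonoid σ) (FreeMonoid.lift X)

/-- `(ℝ^{n×n}_sym)^g`, for `σ = Fin g`: tuples of real symmetric matrices. -/
def IsSymmTuple {n : ℕ} (X : σ → Matrix (Fin n) (Fin n) ℝ) : Prop := ∀ i, (X i).IsSymm

/-! In `ℝ⟨x,h⟩ = NCPoly (σ ⊕ σ)`, `inl i` is the index of `x_i` and `inr i` that of `h_i`. -/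

/-- A polynomial in `x`, seen as a polynomial in `x` and `h`. -/
def toXH : NCPoly σ →ₗ[ℝ] NCPoly (σ ⊕ σ) := extend fun w => monomial (w.map Sum.inl)

/-- The directional derivative of a word in `x` and `h`: the sum, over the positions that hold
some `x_i`, of the words in which this one letter `x_i` is replaced by `h_i`. -/
def wordDeriv : List (σ ⊕ σ) → NCPoly (σ ⊕ σ)
  | [] => 0
  | Sum.inl i :: w => var (Sum.inr i) * monomial w + var (Sum.inl i) * wordDeriv w
  | Sum.inr i :: w => var (Sum.inr i) * wordDeriv w

/-- The directional derivative with respect to `x` in the direction `h`, on `ℝ⟨x,h⟩`. -/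
def dirDeriv : NCPoly (σ ⊕ σ) →ₗ[ℝ] NCPoly (σ ⊕ σ) := extend wordDeriv

/-- The first derivative `p'(x)[h]`. -/
def deriv₁ (p : NCPoly σ) : NCPoly (σ ⊕ σ) := dirDeriv (toXH p)

/-- The Hessian `p''(x)[h]`. -/
def hessian (p : NCPoly σ) : NCPoly (σ ⊕ σ) := dirDeriv (deriv₁ p)

/-- The entry `h_j m(x)` of the vector `Ṽ(x)[h]`, for a word `m`. -/
def borderEntry (j : σ) (m : List σ) : NCPoly (σ ⊕ σ) :=
  var (Sum.inr j) * toXH (monomial m)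

/-- `Ṽ(x)[h]ᵀ Ṽ(x)[h]`: the sum of `(h_j m(x))ᵀ (h_j m(x))` over all `j` and all words `m` of
length less than `d`. -/
def borderSq [Fintype σ] (d : ℕ) : NCPoly (σ ⊕ σ) :=
  ∑ k ∈ Finset.range d, ∑ m : Fin k → σ, ∑ j : σ,
    transpose (borderEntry j (List.ofFn m)) * borderEntry j (List.ofFn m)

/-- The relaxed Hessian
`p''(x)[h] + δ Ṽ(x)[h]ᵀ Ṽ(x)[h] + lam p'(x)[h]ᵀ p'(x)[h]`, where `Ṽ` is formed with the
degree of `p`. -/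
def relaxedHessian [Fintype σ] (p : NCPoly σ) (lam δ : ℝ) : NCPoly (σ ⊕ σ) :=
  hessian p + δ • borderSq (degree p) + lam • (transpose (deriv₁ p) * deriv₁ p)

/-- The relaxed Hessian of `p` is positive at `(X, v)`: for each `δ > 0` there is a `lam > 0` with
`0 ≤ ⟨p''_{lam,δ}(X)[H] v, v⟩` for all tuples `H` of symmetric matrices. -/
def RelaxedHessianPositiveAt [Fintype σ] (p : NCPoly σ) {n : ℕ}
    (X : σ → Matrix (Fin n) (Fin n) ℝ) (v : Fin n → ℝ) : Prop :=
  ∀ δ : ℝ, 0 < δ → ∃ lam : ℝ, 0 < lam ∧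
    ∀ H : σ → Matrix (Fin n) (Fin n) ℝ, IsSymmTuple H →
      0 ≤ (eval (Sum.elim X H) (relaxedHessian p lam δ)).mulVec v ⬝ᵥ v

/-- Matrix convexity: `p(tX + (1-t)Y) ≼ t p(X) + (1-t) p(Y)` for all tuples of symmetric matrices
of the same, arbitrary size, and `0 ≤ t ≤ 1`. -/
def IsMatrixConvex (p : NCPoly σ) : Prop :=
  ∀ (n : ℕ) (X Y : σ → Matrix (Fin n) (Fin n) ℝ), IsSymmTuple X → IsSymmTuple Y →
    ∀ t : ℝ, 0 ≤ t → t ≤ 1 →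
      (t • eval X p + (1 - t) • eval Y p - eval (t • X + (1 - t) • Y) p).PosSemidef

end NCPoly

end

/-! Since the words of length `< d` applied to `v` are linearly independent, one may prescribe `H j
(m(X) v) = c j m • y` for a scalar array `c`. At one pair `(j₀, m₁)`, with `j₀ m₁` a word of length
`d` in `p`, a term `T y` is added, with `T` chosen so that `p'(X)[H] v = 0`. A symmetric `H` with
these values exists if `y` satisfies `g ν̃(ν̃-1)/2` linear equations; the bound on `n` leaves a
solution `y ≠ 0`.

Letting `δ → 0` gives `⟨p''(X)[H] v, v⟩ ≥ 0`. This number is `⟨M y, y⟩` with `M` depending on `X`,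
`p` and `c` only: the words around the two `h`'s have total length at most `d - 2`, too short to
meet `T`. So no `M` is negative definite (`exists_ne_zero_hessianMatrix_nonneg`).

If `d ≥ 3`, an array supported at `(j₀, [])` and `(k₀, m₀)`, with `j₀ k₀ m₀` a top word, makes `M` a
fixed matrix plus an arbitrary multiple of the identity, a contradiction. If `d = 2`, arrays
supported at the empty word show that the quadratic coefficients form a positive semidefinite
matrix, which gives convexity. -/

open Matrix

namespace NCPoly

/-! ### Linear extension from words, coefficients, derivatives of words. -/

section Words

variable {σ : Type*}

theorem extend_apply {V : Type*} [AddCommGroup V] [Module ℝ V] (f : List σ → V) (p : NCPoly σ) :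
    extend f p = ∑ w ∈ p.coeff.support, p.coeff w • f w.toList := rfl

@[simp]
theorem extend_monomial {V : Type*} [AddCommGroup V] [Module ℝ V] (f : List σ → V) (w : List σ) :
    extend f (monomial w) = f w := by
  simp [extend, monomial]

theorem linearMap_ext {V : Type*} [AddCommGroup V] [Module ℝ V] {f g : NCPoly σ →ₗ[ℝ] V}
    (h : ∀ w, f (monomial w) = g (monomial w)) : f = g :=
  MonoidAlgebra.lhom_ext' fun w => LinearMap.ext_ring (by simpa [monomial] using h w.toList)

theorem map_eq_extend {V : Type*} [AddCommGroup V] [Module ℝ V] (f : NCPoly σ →ₗ[ℝ] V)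
    (p : NCPoly σ) : f p = extend (fun w => f (monomial w)) p := by
  refine LinearMap.congr_fun (f := f) (linearMap_ext fun w => ?_) p
  simp

theorem length_le_degree {p : NCPoly σ} {w : FreeMonoid σ} (hw : w ∈ p.coeff.support) :
    w.toList.length ≤ p.degree :=
  Finset.le_sup (f := FreeMonoid.length) hw

theorem extend_congr {V : Type*} [AddCommGroup V] [Module ℝ V] {f f' : List σ → V} {p : NCPoly σ}
    (h : ∀ w, w.length ≤ p.degree → f w = f' w) : extend f p = extend f' p := by
  rw [extend_apply, extend_apply]
  exact Finset.sum_congr rfl fun w hw => by rw [h _ (length_le_degree hw)]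

theorem map_extend {V W : Type*} [AddCommGroup V] [Module ℝ V] [AddCommGroup W] [Module ℝ W]
    (L : V →ₗ[ℝ] W) (f : List σ → V) (p : NCPoly σ) :
    L (extend f p) = extend (fun w => L (f w)) p := by
  simp [extend_apply]

theorem extend_add {V : Type*} [AddCommGroup V] [Module ℝ V] (f f' : List σ → V) (p : NCPoly σ) :
    extend (fun w => f w + f' w) p = extend f p + extend f' p := by
  simp [extend_apply, Finset.sum_add_distrib]

theorem extend_smul {V : Type*} [AddCommGroup V] [Module ℝ V] (a : ℝ) (f : List σ → V)
    (p : NCPoly σ) : extend (fun w => a • f w) p = a • extend f p :=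
  (map_extend (LinearMap.lsmul ℝ V a) f p).symm

theorem extend_ite [DecidableEq σ] {V : Type*} [AddCommGroup V] [Module ℝ V] (u : List σ) (T : V)
    (p : NCPoly σ) :
    extend (fun w => if w = u then T else 0) p = p.coeff (FreeMonoid.ofList u) • T := by
  have : ∀ w : FreeMonoid σ, w.toList = u ↔ w = FreeMonoid.ofList u := fun w => Iff.rfl
  classical
  rw [extend_apply]
  simp only [this, smul_ite, smul_zero, Finset.sum_ite_eq', Finsupp.mem_support_iff]
  split_ifs with h
  · rfl
  · simp [not_not.mp h]

theorem exists_coeff_ne_zero {p : NCPoly σ} (h : p.degree ≠ 0) :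
    ∃ w : List σ, w.length = p.degree ∧ p.coeff (FreeMonoid.ofList w) ≠ 0 := by
  have hne : p.coeff.support.Nonempty := by
    by_contra h0
    exact h (by simp [degree, Finset.not_nonempty_iff_eq_empty.mp h0])
  obtain ⟨w, hw, hw'⟩ := Finset.exists_mem_eq_sup _ hne FreeMonoid.length
  exact ⟨w.toList, hw'.symm, Finsupp.mem_support_iff.mp hw⟩

theorem coeff_eq_zero_of_degree_lt {p : NCPoly σ} {w : List σ} (h : p.degree < w.length) :
    p.coeff (FreeMonoid.ofList w) = 0 := by
  by_contra h0
  exact absurd (length_le_degree (Finsupp.mem_support_iff.mpr h0)) (not_le.mpr h)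

theorem coeff_monomial [DecidableEq σ] (w u : List σ) :
    (monomial w).coeff (FreeMonoid.ofList u) = if w = u then 1 else 0 := by
  classical
  rw [monomial, MonoidAlgebra.coeff_single, Finsupp.single_apply]
  exact if_congr FreeMonoid.ofList.injective.eq_iff rfl rfl

theorem coeff_transpose (p : NCPoly σ) (u : List σ) :
    (transpose p).coeff (FreeMonoid.ofList u) = p.coeff (FreeMonoid.ofList u.reverse) := by
  classical
  let L : FreeMonoid σ → NCPoly σ →ₗ[ℝ] ℝ := fun w =>
    Finsupp.lapply w ∘ₗ (MonoidAlgebra.coeffLinearEquiv (R := ℝ)).toLinearMap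
  have : L (FreeMonoid.ofList u) ∘ₗ transpose = L (FreeMonoid.ofList u.reverse) :=
    linearMap_ext fun w => by
      have h1 : L (FreeMonoid.ofList u) (monomial w.reverse)
        = (monomial w.reverse).coeff (FreeMonoid.ofList u) := rfl
      have h2 : L (FreeMonoid.ofList u.reverse) (monomial w)
        = (monomial w).coeff (FreeMonoid.ofList u.reverse) := rfl
      rw [LinearMap.comp_apply, transpose, extend_monomial, h1, h2, coeff_monomial, coeff_monomial]
      simp [List.reverse_eq_iff]
  exact LinearMap.congr_fun this p

theorem IsSymmetric.coeff_reverse {p : NCPoly σ} (hp : p.IsSymmetric) (u : List σ) :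
    p.coeff (FreeMonoid.ofList u.reverse) = p.coeff (FreeMonoid.ofList u) := by
  rw [← coeff_transpose, hp]

theorem monomial_append (u w : List σ) : monomial (u ++ w) = monomial u * monomial w := by
  simp [monomial, MonoidAlgebra.single_mul_single]

theorem monomial_cons (i : σ) (w : List σ) : monomial (i :: w) = var i * monomial w :=
  monomial_append [i] w

theorem dirDeriv_var_inl_mul (i : σ) (q : NCPoly (σ ⊕ σ)) :
    dirDeriv (var (Sum.inl i) * q) = var (Sum.inr i) * q + var (Sum.inl i) * dirDeriv q := by
  have : dirDeriv ∘ₗ LinearMap.mulLeft ℝ (var (Sum.inl i)) = LinearMap.mulLeft ℝ (var (Sum.inr i)) +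
      LinearMap.mulLeft ℝ (var (Sum.inl i)) ∘ₗ dirDeriv := linearMap_ext fun w => by
    simp [← monomial_cons, dirDeriv, wordDeriv]
  exact LinearMap.congr_fun this q

theorem dirDeriv_var_inr_mul (i : σ) (q : NCPoly (σ ⊕ σ)) :
    dirDeriv (var (Sum.inr i) * q) = var (Sum.inr i) * dirDeriv q := by
  have : dirDeriv ∘ₗ LinearMap.mulLeft ℝ (var (Sum.inr i)) =
      LinearMap.mulLeft ℝ (var (Sum.inr i)) ∘ₗ dirDeriv := linearMap_ext fun w => by
    simp [← monomial_cons, dirDeriv, wordDeriv]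
  exact LinearMap.congr_fun this q

variable {n : ℕ}

theorem eval_monomial (X : σ → Matrix (Fin n) (Fin n) ℝ) (w : List σ) :
    eval X (monomial w) = (w.map X).prod := by
  simp [eval, monomial, FreeMonoid.lift_apply]

theorem eval_var (X : σ → Matrix (Fin n) (Fin n) ℝ) (i : σ) : eval X (var i) = X i := by
  simp [var, eval_monomial]

theorem wordDeriv_map_inl_cons (i : σ) (w : List σ) :
    wordDeriv ((i :: w).map Sum.inl) =
      var (Sum.inr i) * monomial (w.map Sum.inl) + var (Sum.inl i) * wordDeriv (w.map Sum.inl) :=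
  rfl

theorem deriv₁_eq_extend (p : NCPoly σ) :
    deriv₁ p = extend (fun w => wordDeriv (w.map Sum.inl)) p := by
  rw [deriv₁, toXH, map_extend]
  simp [dirDeriv]

theorem hessian_eq_extend (p : NCPoly σ) :
    hessian p = extend (fun w => dirDeriv (wordDeriv (w.map Sum.inl))) p := by
  rw [hessian, deriv₁_eq_extend, map_extend]

theorem dirDeriv_wordDeriv_cons (i : σ) (w : List σ) :
    dirDeriv (wordDeriv ((i :: w).map Sum.inl)) =
      (2 : ℝ) • (var (Sum.inr i) * wordDeriv (w.map Sum.inl)) +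
        var (Sum.inl i) * dirDeriv (wordDeriv (w.map Sum.inl)) := by
  rw [wordDeriv_map_inl_cons, map_add, dirDeriv_var_inr_mul, dirDeriv_var_inl_mul, dirDeriv,
    extend_monomial, two_smul, add_assoc]

end Words

/-! ### The derivatives at `v` as matrices acting on `y`. -/

section Forms

variable {σ : Type*} {n : ℕ}

/-- The matrix `M` with `p'(X)[H] v = M y` for the word `p = w`, when `H j` maps `m(X) v` to
`c j m • y`. -/
def derivMatrix (X : σ → Matrix (Fin n) (Fin n) ℝ) (c : σ → List σ → ℝ) :
    List σ → Matrix (Fin n) (Fin n) ℝ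
  | [] => 0
  | j :: w => c j w • 1 + X j * derivMatrix X c w

/-- The matrix `M` with `⟪p''(X)[H] v, u(X) v⟫ = ⟪M y, y⟫` for the word `p = w`, when `H j` maps
`m(X) v` to `c j m • y`, polarized in `c`. -/
def hessianMatrix (X : σ → Matrix (Fin n) (Fin n) ℝ) (c c' : σ → List σ → ℝ) :
    List σ → List σ → Matrix (Fin n) (Fin n) ℝ
  | [], _ => 0
  | j :: w, u => (2 * c j u) • derivMatrix X c' w + hessianMatrix X c c' w (j :: u)

theorem derivMatrix_add (X : σ → Matrix (Fin n) (Fin n) ℝ) (c c' : σ → List σ → ℝ) (s : ℝ)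
    (w : List σ) :
    derivMatrix X (c + s • c') w = derivMatrix X c w + s • derivMatrix X c' w := by
  induction w with
  | nil => simp [derivMatrix]
  | cons j w ih =>
    simp only [derivMatrix, ih, Pi.add_apply, Pi.smul_apply, smul_eq_mul, mul_add, mul_smul_comm]
    module

theorem hessianMatrix_add (X : σ → Matrix (Fin n) (Fin n) ℝ) (c c' : σ → List σ → ℝ) (s : ℝ)
    (w u : List σ) :
    hessianMatrix X (c + s • c') (c + s • c') w u = hessianMatrix X c c w u +
      s • (hessianMatrix X c c' w u + hessianMatrix X c' c w u) +
      s ^ 2 • hessianMatrix X c' c' w u := by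
  induction w generalizing u with
  | nil => simp [hessianMatrix]
  | cons j w ih =>
    simp only [hessianMatrix, ih, derivMatrix_add, Pi.add_apply, Pi.smul_apply, smul_eq_mul]
    module

variable [DecidableEq σ]

/-- In a word of length at most `|m₁| + 1`, the suffix after a letter can be `m₁` only for the first
letter, so `T` enters without a factor in front. -/
theorem derivMatrix_mulVec {X H : σ → Matrix (Fin n) (Fin n) ℝ} {v y : Fin n → ℝ}
    {c : σ → List σ → ℝ} {j₀ : σ} {m₁ : List σ} {T : Matrix (Fin n) (Fin n) ℝ}
    (hH : ∀ j m, m.length ≤ m₁.length → H j *ᵥ ((m.map X).prod *ᵥ v) =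
      (c j m • 1 + if j = j₀ ∧ m = m₁ then T else 0 : Matrix (Fin n) (Fin n) ℝ) *ᵥ y)
    (w : List σ) (hw : w.length ≤ m₁.length + 1) :
    eval (Sum.elim X H) (wordDeriv (w.map Sum.inl)) *ᵥ v =
      (derivMatrix X c w + if w = j₀ :: m₁ then T else 0) *ᵥ y := by
  induction w with
  | nil => simp [wordDeriv, derivMatrix]
  | cons j w ih =>
    simp only [List.length_cons, add_le_add_iff_right] at hw
    rw [wordDeriv_map_inl_cons, map_add, map_mul, map_mul, eval_var, eval_var, eval_monomial,
      List.map_map, Sum.elim_comp_inl, Sum.elim_inr, Sum.elim_inl, add_mulVec, ← mulVec_mulVec,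
      ← mulVec_mulVec, ih (by omega), hH j w hw,
      if_neg (show w ≠ j₀ :: m₁ by rintro rfl; simp at hw), mulVec_mulVec,
      ← add_mulVec, add_zero, derivMatrix]
    congr 1
    simp only [List.cons.injEq]
    abel

/-- Symmetry of `X` and `H` moves letters to the other side of the inner product; `u` is the
reversed prefix already moved. -/
theorem hessianMatrix_mulVec {X H : σ → Matrix (Fin n) (Fin n) ℝ} (hX : IsSymmTuple X)
    (hHs : IsSymmTuple H) {v y : Fin n → ℝ}
    {c : σ → List σ → ℝ} {j₀ : σ} {m₁ : List σ} {T : Matrix (Fin n) (Fin n) ℝ}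
    (hH : ∀ j m, m.length ≤ m₁.length → H j *ᵥ ((m.map X).prod *ᵥ v) =
      (c j m • 1 + if j = j₀ ∧ m = m₁ then T else 0 : Matrix (Fin n) (Fin n) ℝ) *ᵥ y)
    (w u : List σ) (hw : w.length + u.length ≤ m₁.length + 1) :
    (eval (Sum.elim X H) (dirDeriv (wordDeriv (w.map Sum.inl))) *ᵥ v) ⬝ᵥ
      ((u.map X).prod *ᵥ v) = (hessianMatrix X c c w u *ᵥ y) ⬝ᵥ y := by
  have hsymm : ∀ {M : Matrix (Fin n) (Fin n) ℝ}, M.IsSymm → ∀ a b : Fin n → ℝ,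
      (M *ᵥ a) ⬝ᵥ b = a ⬝ᵥ (M *ᵥ b) := fun {M} hM a b => by
    rw [dotProduct_mulVec, ← mulVec_transpose, hM.eq]
  induction w generalizing u with
  | nil => simp [wordDeriv, hessianMatrix]
  | cons j w ih =>
    simp only [List.length_cons] at hw
    have h := ih (j :: u) (by simp only [List.length_cons]; omega)
    rw [List.map_cons, List.prod_cons, ← mulVec_mulVec] at h
    have hD := derivMatrix_mulVec hH w (by omega)
    rw [if_neg (by rintro rfl; simp only [List.length_cons] at hw; omega), add_zero] at hD
    rw [dirDeriv_wordDeriv_cons, map_add, map_smul, map_mul, map_mul, eval_var, eval_var,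
      Sum.elim_inr, Sum.elim_inl, add_mulVec, smul_mulVec, ← mulVec_mulVec, ← mulVec_mulVec,
      add_dotProduct, smul_dotProduct, hsymm (hX j), h, hsymm (hHs j), hD, hH j u (by omega),
      hessianMatrix, add_mulVec ((2 * c j u) • _), add_dotProduct]
    congr 1
    -- The term `T` needs `u = m₁`, which forces `w = []`; then no letter is left for the second
    -- `h`.
    rcases w with _ | ⟨k, w⟩
    · simp [derivMatrix]
    · rw [if_neg]
      · simp only [add_zero, smul_mulVec, one_mulVec, dotProduct_smul, smul_dotProduct, smul_eq_mul]
        ring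
      · rintro ⟨-, rfl⟩
        simp only [List.length_cons] at hw
        omega

end Forms

/-! ### Symmetric matrices with prescribed values. -/

section Existence

/-- A symmetric matrix with prescribed values on linearly independent vectors exists when the
prescription is compatible with symmetry. -/
theorem exists_isSymm_mulVec_eq {ι : Type*} [Fintype ι] {n : ℕ}
    {e z : ι → Fin n → ℝ} (he : LinearIndependent ℝ e) (h : ∀ a b, z a ⬝ᵥ e b = z b ⬝ᵥ e a) :
    ∃ H : Matrix (Fin n) (Fin n) ℝ, H.IsSymm ∧ ∀ a, H *ᵥ e a = z a := by
  classical
  let A : Matrix (Fin n) ι ℝ := (Matrix.of e)ᵀ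
  let Z : Matrix (Fin n) ι ℝ := (Matrix.of z)ᵀ
  have hA : LinearMap.ker A.mulVecLin = ⊥ :=
    LinearMap.ker_eq_bot.mpr (Matrix.mulVec_injective_iff.mpr he)
  obtain ⟨l, hl⟩ := A.mulVecLin.exists_leftInverse_of_injective hA
  let L : Matrix ι (Fin n) ℝ := LinearMap.toMatrix' l
  have hL : L * A = 1 := by
    rw [← LinearMap.toMatrix'_id, ← hl, LinearMap.toMatrix'_comp]
    exact congrArg _ (LinearMap.toMatrix'_toLin' A).symm
  have hZ : Aᵀ * Z = Zᵀ * A := by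
    ext a b
    change e a ⬝ᵥ z b = z a ⬝ᵥ e b
    rw [h a b, dotProduct_comm]
  -- `Z * L` has the right values; adding its transpose makes it symmetric, and the last term,
  -- symmetric by `hZ`, cancels the error on the range of `A`.
  refine ⟨Z * L + Lᵀ * Zᵀ - Lᵀ * (Aᵀ * Z) * L, ?_, fun a => ?_⟩
  · rw [Matrix.IsSymm]
    simp only [transpose_sub, transpose_add, transpose_mul, transpose_transpose]
    rw [add_comm (Lᵀ * Zᵀ), ← hZ, Matrix.mul_assoc Lᵀ]
  · have hH : (Z * L + Lᵀ * Zᵀ - Lᵀ * (Aᵀ * Z) * L) * A = Z := by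
      rw [Matrix.sub_mul, Matrix.add_mul, Matrix.mul_assoc Z, Matrix.mul_assoc _ L, hL, hZ,
        Matrix.mul_one, Matrix.mul_one, Matrix.mul_assoc, add_sub_cancel_right]
    ext i
    exact congrFun (congrFun hH i) a

/-- The conditions are linear in `y`, and those with `b < a` suffice: `N(N-1)/2` for each `j`, fewer
than `n` in all. -/
theorem exists_ne_zero_forall_dotProduct_eq {τ : Type*} [Fintype τ] {n N : ℕ}
    (e : Fin N → Fin n → ℝ) (Y : τ → Fin N → Matrix (Fin n) (Fin n) ℝ)
    (h : Fintype.card τ * (N * (N - 1)) < 2 * n) :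
    ∃ y : Fin n → ℝ, y ≠ 0 ∧
      ∀ j a b, (Y j a *ᵥ y) ⬝ᵥ e b = (Y j b *ᵥ y) ⬝ᵥ e a := by
  let φ : (Fin n → ℝ) →ₗ[ℝ] (τ × (Σ a : Fin N, Fin a) → ℝ) := LinearMap.pi fun q =>
    dotProductBilin ℝ ℝ (e (Fin.castLE q.2.1.2.le q.2.2)) ∘ₗ (Y q.1 q.2.1).mulVecLin -
      dotProductBilin ℝ ℝ (e q.2.1) ∘ₗ (Y q.1 (Fin.castLE q.2.1.2.le q.2.2)).mulVecLin
  have hφ : LinearMap.ker φ ≠ ⊥ := by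
    apply LinearMap.ker_ne_bot_of_finrank_lt
    have h2 := Finset.sum_range_id_mul_two N
    rw [Module.finrank_fintype_fun_eq_card, Module.finrank_fintype_fun_eq_card, Fintype.card_prod,
      Fintype.card_sigma, Fintype.card_fin]
    simp only [Fintype.card_fin]
    rw [Fin.sum_univ_eq_sum_range (fun i => i) N]
    rw [← h2] at h
    nlinarith
  obtain ⟨y, hy, hy0⟩ := Submodule.exists_mem_ne_zero_of_ne_bot hφ
  refine ⟨y, hy0, fun j => ?_⟩
  have key : ∀ a b : Fin N, b < a → (Y j a *ᵥ y) ⬝ᵥ e b = (Y j b *ᵥ y) ⬝ᵥ e a := fun a b hab => by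
    have := congrFun (LinearMap.mem_ker.mp hy) (j, ⟨a, ⟨b, hab⟩⟩)
    simp only [φ, LinearMap.pi_apply, LinearMap.sub_apply, LinearMap.comp_apply,
      Matrix.mulVecLin_apply, Pi.zero_apply, sub_eq_zero] at this
    rw [dotProduct_comm, dotProduct_comm _ (e a)]
    exact this
  intro a b
  rcases lt_trichotomy a b with hab | rfl | hab
  · exact (key b a hab).symm
  · rfl
  · exact key a b hab

theorem exists_enumeration (g d : ℕ) : ∃ E : Fin (∑ k ∈ Finset.range d, g ^ k) → List (Fin g),
    Function.Injective E ∧ ∀ w, (∃ a, E a = w) ↔ w.length < d := by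
  have hcard : Fintype.card (Σ k : Fin d, Fin k → Fin g) = ∑ k ∈ Finset.range d, g ^ k := by
    simp [Fintype.card_sigma, Fin.sum_univ_eq_sum_range (fun k => g ^ k) d]
  let f := (Fintype.equivFinOfCardEq hcard).symm
  have hF : Function.Injective fun s : (Σ k : Fin d, Fin k → Fin g) => List.ofFn s.2 := by
    rintro ⟨⟨k, hk⟩, u⟩ ⟨⟨l, hl⟩, u'⟩ hab
    have := List.ofFn_inj'.mp hab
    simp only [Sigma.mk.injEq] at this
    obtain ⟨rfl, h2⟩ := this
    rw [eq_of_heq h2]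
  refine ⟨fun a => List.ofFn (f a).2, fun a b hab => f.injective (hF hab), fun w => ⟨?_, fun hw => ?_⟩⟩
  · rintro ⟨a, rfl⟩
    simp
  · exact ⟨f.symm ⟨⟨w.length, hw⟩, w.get⟩,
      (congrArg (fun s : (Σ k : Fin d, Fin k → Fin g) => List.ofFn s.2)
        (f.apply_symm_apply _)).trans (List.ofFn_get w)⟩

theorem linearIndependent_words {g d n N : ℕ} {X : Fin g → Matrix (Fin n) (Fin n) ℝ}
    {v : Fin n → ℝ}
    (hq : ∀ q : NCPoly (Fin g), q ≠ 0 → q.degree < d → (NCPoly.eval X q).mulVec v ≠ 0)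
    {E : Fin N → List (Fin g)} (hE : Function.Injective E) (hd : ∀ a, (E a).length < d) :
    LinearIndependent ℝ fun a => ((E a).map X).prod *ᵥ v := by
  classical
  rw [Fintype.linearIndependent_iff]
  intro r hr
  set q : NCPoly (Fin g) := ∑ a, r a • monomial (E a) with hqdef
  have hcoeff : ∀ u : List (Fin g), q.coeff (FreeMonoid.ofList u) =
      ∑ a, r a * if E a = u then 1 else 0 := fun u => by
    simp only [← coeff_monomial]
    simp [hqdef, MonoidAlgebra.coeff_sum, Finsupp.finsetSum_apply]
  have hq0 : q = 0 := by
    by_contra hne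
    refine hq q hne ?_ ?_
    · by_contra hlt
      push Not at hlt
      -- The zero polynomial has degree `0`, so `d = 0` must be excluded before a word of top degree
      -- is taken.
      rcases Nat.eq_zero_or_pos N with rfl | hN
      · exact hne (by simp [hqdef])
      have hd0 : 0 < d := (Nat.zero_le _).trans_lt (hd ⟨0, hN⟩)
      obtain ⟨w, hw, hw0⟩ := exists_coeff_ne_zero (p := q) (by omega)
      refine hw0 ?_
      rw [hcoeff]
      refine Finset.sum_eq_zero fun a _ => ?_
      rw [if_neg, mul_zero]
      rintro rfl
      have := hd a
      omega
    · rw [← hr, hqdef, map_sum, Matrix.sum_mulVec]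
      simp [eval_monomial, smul_mulVec]
  intro a
  have := hcoeff (E a)
  rw [hq0] at this
  simpa [hE.eq_iff] using this.symm

end Existence

/-! ### Linear extension and evaluation; degree at most two. -/

section Extend

variable {σ : Type*} {n : ℕ}

theorem extend_mulVec (F : List σ → Matrix (Fin n) (Fin n) ℝ) (p : NCPoly σ) (y : Fin n → ℝ) :
    extend F p *ᵥ y = extend (fun w => F w *ᵥ y) p := by
  simp [extend_apply, sum_mulVec, smul_mulVec]

theorem extend_dotProduct (F : List σ → Fin n → ℝ) (p : NCPoly σ) (y : Fin n → ℝ) :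
    extend F p ⬝ᵥ y = extend (fun w => F w ⬝ᵥ y) p := by
  simp [extend_apply, sum_dotProduct, smul_dotProduct]

theorem eval_extend {τ : Type*} (Z : τ → Matrix (Fin n) (Fin n) ℝ) (F : List σ → NCPoly τ)
    (p : NCPoly σ) : eval Z (extend F p) = extend (fun w => eval Z (F w)) p :=
  map_extend (eval Z).toLinearMap F p

theorem extend_sum {τ V : Type*} [AddCommGroup V] [Module ℝ V] (s : Finset τ) (f : τ → List σ → V)
    (p : NCPoly σ) : extend (fun w => ∑ i ∈ s, f i w) p = ∑ i ∈ s, extend (f i) p := by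
  simp only [extend_apply, Finset.smul_sum]
  exact Finset.sum_comm

theorem extend_eq_sum_of_degree_le_two [Fintype σ] {V : Type*} [AddCommGroup V] [Module ℝ V]
    {f : List σ → V} (h0 : f [] = 0) (h1 : ∀ j, f [j] = 0) {p : NCPoly σ} (hp : p.degree ≤ 2) :
    extend f p = ∑ j, ∑ k, p.coeff (FreeMonoid.ofList [j, k]) • f [j, k] := by
  classical
  have : extend f p = extend (fun w => ∑ j, ∑ k, if w = [j, k] then f [j, k] else 0) p := by
    refine extend_congr fun w hw => ?_
    rcases w with _ | ⟨a, _ | ⟨b, _ | ⟨c, w⟩⟩⟩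
    · simp [h0]
    · simp [h1]
    · simp [ite_and]
    · simp only [List.length_cons] at hw
      omega
  rw [this, extend_sum]
  refine Finset.sum_congr rfl fun j _ => ?_
  rw [extend_sum]
  exact Finset.sum_congr rfl fun k _ => extend_ite _ _ _

end Extend

/-! ### Convexity from the quadratic coefficients. -/

section Convexity

variable {σ : Type*}

/-- The convexity defect is `t(1-t) ∑ p_jk D_j D_k` with `D = X - Y`. Its form at `x` is a sum over
coordinates `s` of the scalar form at `a j = (D j x)_s`. -/
theorem isMatrixConvex_of_degree_le_two [Fintype σ] {p : NCPoly σ} (hp : p.IsSymmetric)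
    (hd : p.degree ≤ 2)
    (h : ∀ a : σ → ℝ, 0 ≤ ∑ j, ∑ k, p.coeff (FreeMonoid.ofList [j, k]) * (a j * a k)) :
    p.IsMatrixConvex := by
  intro n X Y hX hY t ht0 ht1
  let D : σ → Matrix (Fin n) (Fin n) ℝ := fun j => X j - Y j
  have hD : ∀ j, (D j)ᵀ = D j := fun j => by
    simp only [D, transpose_sub, (hX j).eq, (hY j).eq]
  have hdef : t • eval X p + (1 - t) • eval Y p - eval (t • X + (1 - t) • Y) p =
      (t * (1 - t)) • ∑ j, ∑ k, p.coeff (FreeMonoid.ofList [j, k]) • (D j * D k) := by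
    have hL := map_eq_extend (t • (eval X).toLinearMap + (1 - t) • (eval Y).toLinearMap -
      (eval (t • X + (1 - t) • Y)).toLinearMap) p
    simp only [LinearMap.sub_apply, LinearMap.add_apply, LinearMap.smul_apply,
      AlgHom.toLinearMap_apply, eval_monomial] at hL
    rw [hL, extend_eq_sum_of_degree_le_two _ _ hd, Finset.smul_sum]
    · refine Finset.sum_congr rfl fun j _ => ?_
      rw [Finset.smul_sum]
      refine Finset.sum_congr rfl fun k _ => ?_
      rw [smul_comm (t * (1 - t))]
      congr 1
      simp only [List.map_cons, List.map_nil, List.prod_cons, List.prod_nil, mul_one, D,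
        Pi.add_apply, Pi.smul_apply, mul_add, add_mul, mul_sub, sub_mul, smul_mul_assoc,
        mul_smul_comm]
      module
    · simp only [List.map_nil, List.prod_nil]
      module
    · intro j
      simp
  rw [hdef]
  refine PosSemidef.smul (PosSemidef.of_dotProduct_mulVec_nonneg ?_ fun x => ?_)
    (mul_nonneg ht0 (sub_nonneg.mpr ht1))
  · rw [Matrix.IsHermitian, conjTranspose_eq_transpose_of_trivial]
    simp only [transpose_sum, transpose_smul, transpose_mul, hD]
    rw [Finset.sum_comm]
    exact Finset.sum_congr rfl fun j _ => Finset.sum_congr rfl fun k _ => by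
      rw [← hp.coeff_reverse]; rfl
  · have hjk : ∀ j k, x ⬝ᵥ ((D j * D k) *ᵥ x) = (D j *ᵥ x) ⬝ᵥ (D k *ᵥ x) := fun j k => by
      rw [← mulVec_mulVec, dotProduct_mulVec, ← mulVec_transpose, hD]
    simp only [star_trivial, sum_mulVec, smul_mulVec, dotProduct_sum, dotProduct_smul, hjk,
      smul_eq_mul]
    simp only [dotProduct, Finset.mul_sum]
    rw [Finset.sum_congr rfl fun j _ => Finset.sum_comm, Finset.sum_comm]
    exact Finset.sum_nonneg fun s _ => h fun j => (D j *ᵥ x) s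

end Convexity

/-! ### From the relaxed Hessian to a form in `y`. -/

section Positivity

/-- Positivity of the relaxed Hessian forces positivity of the Hessian on the directions along
which the first derivative vanishes. -/
theorem RelaxedHessianPositiveAt.hessian_nonneg {σ : Type*} [Fintype σ] {p : NCPoly σ} {n : ℕ}
    {X : σ → Matrix (Fin n) (Fin n) ℝ} {v : Fin n → ℝ} (hpos : p.RelaxedHessianPositiveAt X v)
    {H : σ → Matrix (Fin n) (Fin n) ℝ} (hH : IsSymmTuple H)
    (h0 : eval (Sum.elim X H) (deriv₁ p) *ᵥ v = 0) :
    0 ≤ (eval (Sum.elim X H) (hessian p) *ᵥ v) ⬝ᵥ v := by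
  set Z := Sum.elim X H
  -- `lam` depends on `δ`, but its term vanishes by `h0`, so `δ` can tend to `0`.
  have hδ : ∀ δ : ℝ, 0 < δ → 0 ≤ (eval Z (hessian p) *ᵥ v) ⬝ᵥ v +
      δ * ((eval Z (borderSq p.degree) *ᵥ v) ⬝ᵥ v) := fun δ hδ => by
    obtain ⟨lam, -, h⟩ := hpos δ hδ
    have := h H hH
    rwa [relaxedHessian, map_add, map_add, map_smul, map_smul, map_mul, add_mulVec, add_mulVec,
      smul_mulVec, smul_mulVec, ← mulVec_mulVec, h0, mulVec_zero, smul_zero, add_zero,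
      add_dotProduct, smul_dotProduct, smul_eq_mul] at this
  refine ge_of_tendsto (f := fun δ : ℝ => (eval Z (hessian p) *ᵥ v) ⬝ᵥ v +
      δ * ((eval Z (borderSq p.degree) *ᵥ v) ⬝ᵥ v)) (x := nhdsWithin 0 (Set.Ioi 0)) ?_
    (eventually_nhdsWithin_of_forall hδ)
  refine Filter.Tendsto.mono_left ?_ nhdsWithin_le_nhds
  have : Continuous fun δ : ℝ => (eval Z (hessian p) *ᵥ v) ⬝ᵥ v +
      δ * ((eval Z (borderSq p.degree) *ᵥ v) ⬝ᵥ v) := by fun_prop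
  simpa using this.tendsto 0

theorem exists_ne_zero_hessianMatrix_nonneg {g n : ℕ} {p : NCPoly (Fin g)} (hd : p.degree ≠ 0)
    (hn : g * ((∑ k ∈ Finset.range p.degree, g ^ k) *
      ((∑ k ∈ Finset.range p.degree, g ^ k) - 1)) < 2 * n)
    {X : Fin g → Matrix (Fin n) (Fin n) ℝ} (hX : IsSymmTuple X) {v : Fin n → ℝ}
    (hq : ∀ q : NCPoly (Fin g), q ≠ 0 → q.degree < p.degree → (NCPoly.eval X q).mulVec v ≠ 0)
    (hpos : p.RelaxedHessianPositiveAt X v) (c : Fin g → List (Fin g) → ℝ) :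
    ∃ y : Fin n → ℝ, y ≠ 0 ∧
      0 ≤ (extend (fun w => hessianMatrix X c c w []) p *ᵥ y) ⬝ᵥ y := by
  obtain ⟨w₀, hw₀, hpw⟩ := exists_coeff_ne_zero hd
  obtain ⟨j₀, m₁, rfl⟩ := List.exists_cons_of_length_pos (l := w₀) (by omega)
  rw [List.length_cons] at hw₀
  obtain ⟨E, hEinj, hE⟩ := exists_enumeration g p.degree
  -- The value of `T` solves `p'(X)[H] v = 0`. It does not involve `y`, so the symmetry conditions
  -- stay linear in `y`.
  let T : Matrix (Fin n) (Fin n) ℝ :=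
    -((p.coeff (FreeMonoid.ofList (j₀ :: m₁)))⁻¹ • extend (derivMatrix X c) p)
  let Y : Fin g → Fin (∑ k ∈ Finset.range p.degree, g ^ k) → Matrix (Fin n) (Fin n) ℝ :=
    fun j a => c j (E a) • 1 + if j = j₀ ∧ E a = m₁ then T else 0
  obtain ⟨y, hy0, hy⟩ := exists_ne_zero_forall_dotProduct_eq
    (fun a => ((E a).map X).prod *ᵥ v) Y (by simpa using hn)
  choose H hHs hH using fun j => exists_isSymm_mulVec_eq
    (linearIndependent_words hq hEinj fun a => (hE _).mp ⟨a, rfl⟩) (hy j)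
  have hHm : ∀ j m, m.length ≤ m₁.length → H j *ᵥ ((m.map X).prod *ᵥ v) =
      (c j m • 1 + if j = j₀ ∧ m = m₁ then T else 0 : Matrix (Fin n) (Fin n) ℝ) *ᵥ y := by
    intro j m hm
    obtain ⟨a, rfl⟩ := (hE m).mpr (by omega)
    exact hH j a
  refine ⟨y, hy0, ?_⟩
  have hD : eval (Sum.elim X H) (deriv₁ p) *ᵥ v = 0 := by
    rw [deriv₁_eq_extend, eval_extend, extend_mulVec,
      extend_congr fun w hw => derivMatrix_mulVec hHm w (by omega), ← extend_mulVec, extend_add,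
      extend_ite]
    rw [smul_neg, smul_smul, mul_inv_cancel₀ hpw, one_smul, add_neg_cancel, zero_mulVec]
  have := hpos.hessian_nonneg hHs hD
  rw [hessian_eq_extend, eval_extend, extend_mulVec, extend_dotProduct] at this
  rw [extend_mulVec, extend_dotProduct]
  refine this.trans_eq (extend_congr fun w hw => ?_)
  have := hessianMatrix_mulVec hX hHs hHm w [] (by rw [List.length_nil]; omega)
  rwa [List.map_nil, List.prod_nil, one_mulVec] at this

end Positivity

/-! ### Arrays that exclude degree three and more. -/

section Degree

variable {σ : Type*} {n : ℕ} [DecidableEq σ]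

theorem derivMatrix_eq_of_support (X : σ → Matrix (Fin n) (Fin n) ℝ) (k₀ : σ) (m₀ : List σ)
    (w : List σ) (hw : w.length ≤ m₀.length + 1) :
    derivMatrix X (fun j m => if j = k₀ ∧ m = m₀ then 1 else 0) w =
      if w = k₀ :: m₀ then 1 else 0 := by
  induction w with
  | nil => simp [derivMatrix]
  | cons j w ih =>
    rw [List.length_cons] at hw
    rw [derivMatrix, ih (by omega), if_neg (show w ≠ k₀ :: m₀ by rintro rfl; simp at hw)]
    simp [ite_smul]

/-- A nonzero term would need `m₀` on both outer sides of the two `h`'s, hence length at least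
`2|m₀| + 2`, too long as `m₀ ≠ []`. -/
theorem hessianMatrix_eq_zero_of_support (X : σ → Matrix (Fin n) (Fin n) ℝ) (k₀ : σ) {m₀ : List σ}
    (hm : m₀ ≠ []) (w u : List σ) (hw : w.length + u.length ≤ m₀.length + 2) :
    hessianMatrix X (fun j m => if j = k₀ ∧ m = m₀ then 1 else 0)
      (fun j m => if j = k₀ ∧ m = m₀ then 1 else 0) w u = 0 := by
  have hm' := List.length_pos_iff.mpr hm
  induction w generalizing u with
  | nil => rfl
  | cons j w ih =>
    rw [List.length_cons] at hw
    rw [hessianMatrix, ih _ (by rw [List.length_cons]; omega),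
      derivMatrix_eq_of_support X k₀ m₀ w (by omega), add_zero]
    by_cases h : u = m₀
    · subst h
      rw [if_neg (show w ≠ k₀ :: u by rintro rfl; rw [List.length_cons] at hw; omega), smul_zero]
    · simp [h]

theorem hessianMatrix_nil_support_left (X : σ → Matrix (Fin n) (Fin n) ℝ) (c : σ → List σ → ℝ)
    (j₀ : σ) (w u : List σ) (hu : u ≠ []) :
    hessianMatrix X (fun j m => if j = j₀ ∧ m = [] then 1 else 0) c w u = 0 := by
  induction w generalizing u with
  | nil => rfl
  | cons j w ih => simp [hessianMatrix, ih _ (List.cons_ne_nil j u), hu]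

/-- The left `h` must replace the first letter, and the right one a letter followed by `m₀`; the
length bound makes these two letters adjacent. -/
theorem hessianMatrix_support_left (X : σ → Matrix (Fin n) (Fin n) ℝ) (j₀ k₀ : σ) (m₀ : List σ)
    (w : List σ) (hw : w.length ≤ m₀.length + 2) :
    hessianMatrix X (fun j m => if j = j₀ ∧ m = [] then 1 else 0)
      (fun j m => if j = k₀ ∧ m = m₀ then 1 else 0) w [] =
      if w = j₀ :: k₀ :: m₀ then (2 : ℝ) • 1 else 0 := by
  rcases w with _ | ⟨j, w⟩
  · simp [hessianMatrix]
  · rw [List.length_cons] at hw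
    rw [hessianMatrix, hessianMatrix_nil_support_left _ _ _ _ _ (List.cons_ne_nil _ _),
      derivMatrix_eq_of_support X k₀ m₀ w (by omega)]
    by_cases h : j = j₀ <;> simp [h]

/-- The mirror image: the full word is `u.reverse ++ w`, and its reverse must be `j₀ k₀ m₀`. The
bound on `u` says that the letter `k₀` has not yet been passed. -/
theorem hessianMatrix_support_right (X : σ → Matrix (Fin n) (Fin n) ℝ) (j₀ k₀ : σ) (m₀ : List σ)
    (w u : List σ) (hw : w.length + u.length ≤ m₀.length + 2) (hu : u.length ≤ m₀.length) :
    hessianMatrix X (fun j m => if j = k₀ ∧ m = m₀ then 1 else 0)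
      (fun j m => if j = j₀ ∧ m = [] then 1 else 0) w u =
      if w.reverse ++ u = j₀ :: k₀ :: m₀ then (2 : ℝ) • 1 else 0 := by
  induction w generalizing u with
  | nil =>
    rw [if_neg]
    · rfl
    · rintro h
      rw [List.reverse_nil, List.nil_append] at h
      rw [h] at hu
      simp at hu
  | cons j w ih =>
    rw [List.length_cons] at hw
    rw [hessianMatrix]
    rcases hu.lt_or_eq with hlt | heq
    · rw [ih _ (by rw [List.length_cons]; omega) (by rw [List.length_cons]; omega),
        if_neg (by rintro ⟨-, rfl⟩; exact lt_irrefl _ hlt)]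
      simp
    · rcases w with _ | ⟨k, w⟩
      · rw [if_neg (show ¬[j].reverse ++ u = j₀ :: k₀ :: m₀ from ?_)]
        · simp [derivMatrix, hessianMatrix]
        · intro h
          have := congrArg List.length h
          simp at this
          omega
      · obtain rfl : w = [] := by
          rw [List.length_cons] at hw
          exact List.length_eq_zero_iff.mp (by omega)
        by_cases h1 : k = j₀ <;> by_cases h2 : j = k₀ <;> by_cases h3 : u = m₀ <;>
          simp [hessianMatrix, derivMatrix, h1, h2, h3]

theorem dotProduct_mulVec_self_le (A : Matrix (Fin n) (Fin n) ℝ) :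
    ∃ C : ℝ, ∀ y : Fin n → ℝ, (A *ᵥ y) ⬝ᵥ y ≤ C * (y ⬝ᵥ y) := by
  refine ⟨∑ i, ∑ j, |A i j|, fun y => ?_⟩
  have hsq : ∀ i, y i * y i ≤ y ⬝ᵥ y := fun i =>
    Finset.single_le_sum (f := fun i => y i * y i) (fun i _ => mul_self_nonneg _)
      (Finset.mem_univ i)
  simp only [dotProduct, mulVec, Finset.sum_mul]
  refine Finset.sum_le_sum fun i _ => Finset.sum_le_sum fun j _ => ?_
  calc A i j * y j * y i ≤ |A i j * (y j * y i)| := by rw [mul_assoc]; exact le_abs_self _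
    _ = |A i j| * |y j * y i| := abs_mul _ _
    _ ≤ |A i j| * (y ⬝ᵥ y) := by
        gcongr
        rw [abs_le]
        constructor <;> nlinarith [hsq i, hsq j, sq_nonneg (y i + y j), sq_nonneg (y i - y j)]

end Degree

end NCPoly

open NCPoly in
theorem theorem1p3 {g d n : ℕ} (p : NCPoly (Fin g)) (hp : p.IsSymmetric) (hd : p.degree = d)
    (hn : (1 / 2 : ℝ) * g * (∑ k ∈ Finset.range d, (g : ℝ) ^ k) *
      ((∑ k ∈ Finset.range d, (g : ℝ) ^ k) - 1) < n)
    (X : Fin g → Matrix (Fin n) (Fin n) ℝ) (hX : NCPoly.IsSymmTuple X) (v : Fin n → ℝ)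
    (hq : ∀ q : NCPoly (Fin g), q ≠ 0 → q.degree < d → (NCPoly.eval X q).mulVec v ≠ 0)
    (hpos : p.RelaxedHessianPositiveAt X v) :
    p.IsMatrixConvex ∧ p.degree ≤ 2 := by
  subst hd
  by_cases hd1 : p.degree ≤ 1
  · refine ⟨isMatrixConvex_of_degree_le_two hp (by omega) fun a => ?_, by omega⟩
    refine Finset.sum_nonneg fun j _ => Finset.sum_nonneg fun k _ => ?_
    rw [coeff_eq_zero_of_degree_lt (by simp only [List.length_cons, List.length_nil]; omega),
      zero_mul]
  push Not at hd1
  have hn' : g * ((∑ k ∈ Finset.range p.degree, g ^ k) *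
      ((∑ k ∈ Finset.range p.degree, g ^ k) - 1)) < 2 * n := by
    -- The empty word makes the count at least `1`, so the natural subtraction is not truncated.
    have h1 : 1 ≤ ∑ k ∈ Finset.range p.degree, g ^ k :=
      Finset.single_le_sum (f := fun k => g ^ k) (fun _ _ => Nat.zero_le _)
        (Finset.mem_range.mpr (show 0 < p.degree by omega))
    have : ((g * ((∑ k ∈ Finset.range p.degree, g ^ k) *
      ((∑ k ∈ Finset.range p.degree, g ^ k) - 1)) : ℕ) : ℝ) < ((2 * n : ℕ) : ℝ) := by
      push_cast [Nat.cast_sub h1]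
      linarith
    exact_mod_cast this
  have key := exists_ne_zero_hessianMatrix_nonneg (by omega) hn' hX hq hpos
  have hdeg : p.degree ≤ 2 := by
    by_contra! h3
    obtain ⟨w₀, hw₀, hpw⟩ := exists_coeff_ne_zero (p := p) (by omega)
    obtain ⟨j₀, k₀, m₀, rfl⟩ : ∃ j k m, w₀ = j :: k :: m := by
      rcases w₀ with _ | ⟨j, _ | ⟨k, m⟩⟩
      · simp at hw₀; omega
      · simp at hw₀; omega
      · exact ⟨j, k, m, rfl⟩
    simp only [List.length_cons] at hw₀
    have hm₀ : m₀ ≠ [] := by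
      rintro rfl
      simp at hw₀
      omega
    set r := p.coeff (FreeMonoid.ofList (j₀ :: k₀ :: m₀)) with hr
    let c₀ : Fin g → List (Fin g) → ℝ := fun j m => if j = j₀ ∧ m = [] then 1 else 0
    let c₁ : Fin g → List (Fin g) → ℝ := fun j m => if j = k₀ ∧ m = m₀ then 1 else 0
    let A := extend (fun w => hessianMatrix X c₀ c₀ w []) p
    obtain ⟨C, hC⟩ := dotProduct_mulVec_self_le A
    -- The top word and its reverse each contribute `2r` to the cross term, also when they coincide.
    -- This `s` turns the form into `A - (C + 1)`, which is negative definite.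
    let s : ℝ := -(C + 1) / (4 * r)
    have hsum : extend (fun w => hessianMatrix X (c₀ + s • c₁) (c₀ + s • c₁) w []) p =
        A + (s * (4 * r)) • 1 := by
      have : ∀ w : List (Fin g), w.length ≤ p.degree →
          hessianMatrix X (c₀ + s • c₁) (c₀ + s • c₁) w [] = hessianMatrix X c₀ c₀ w [] +
            s • ((if w = j₀ :: k₀ :: m₀ then (2 : ℝ) • 1 else 0) +
              if w = (j₀ :: k₀ :: m₀).reverse then (2 : ℝ) • 1 else 0) := fun w hw => by
        rw [hessianMatrix_add, hessianMatrix_support_left X j₀ k₀ m₀ w (by omega),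
          hessianMatrix_support_right X j₀ k₀ m₀ w [] (by rw [List.length_nil]; omega) (by simp),
          hessianMatrix_eq_zero_of_support X k₀ hm₀ w [] (by rw [List.length_nil]; omega),
          List.append_nil, smul_zero, add_zero]
        simp only [List.reverse_eq_iff]
      rw [extend_congr this, extend_add, extend_smul, extend_add, extend_ite, extend_ite,
        hp.coeff_reverse]
      module
    obtain ⟨y, hy0, hy⟩ := key (c₀ + s • c₁)
    have hyy : 0 < y ⬝ᵥ y := by
      refine lt_of_le_of_ne (Finset.sum_nonneg fun i _ => mul_self_nonneg _) fun h => hy0 ?_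
      exact dotProduct_self_eq_zero.mp h.symm
    have hs : s * (4 * r) = -(C + 1) := div_mul_cancel₀ _ (by simpa using hpw)
    rw [hsum, hs, add_mulVec, add_dotProduct, smul_mulVec, one_mulVec, smul_dotProduct,
      smul_eq_mul] at hy
    linarith [hC y]
  refine ⟨isMatrixConvex_of_degree_le_two hp hdeg fun a => ?_, hdeg⟩
  -- In degree `2` this array gives `2 ∑ p_jk a_j a_k` times the identity.
  obtain ⟨y, hy0, hy⟩ := key fun j m => if m = [] then a j else 0
  have hyy : 0 < y ⬝ᵥ y := by
    refine lt_of_le_of_ne (Finset.sum_nonneg fun i _ => mul_self_nonneg _) fun h => hy0 ?_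
    exact dotProduct_self_eq_zero.mp h.symm
  rw [extend_eq_sum_of_degree_le_two rfl (fun j => by simp [hessianMatrix, derivMatrix]) hdeg] at hy
  simp only [sum_mulVec, smul_mulVec, sum_dotProduct, smul_dotProduct, smul_eq_mul, hessianMatrix,
    derivMatrix, if_true, mul_zero, add_zero, smul_zero, one_mulVec] at hy
  have : 2 * (∑ j, ∑ k, p.coeff (FreeMonoid.ofList [j, k]) * (a j * a k)) * (y ⬝ᵥ y) ≥ 0 := by
    refine hy.trans_eq ?_
    simp only [Finset.mul_sum, Finset.sum_mul]
    exact Finset.sum_congr rfl fun j _ => Finset.sum_congr rfl fun k _ => by ring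
  nlinarith [nonneg_of_mul_nonneg_left this hyy]
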